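/- Let $n \ge 1$. For $w = (x_1 + i y_1, \dots, x_n + i y_n) \in \mathbf{C}^n$ (with $x_k, y_k$ real) the associated real vectors of $w$ are $$u = (x_1, \dots, x_n, y_1, \dots, y_n), \qquad v = (-y_1, \dots, -y_n, x_1, \dots, x_n) \in \mathbf{R}^{2n}.$$ Let $V = \{w_0, \dots, w_n\} \subset \mathbf{C}^n$ be a set of $n+1$ distinct unit vectors which is the vertex set of a real regular simplex, that is, all coordinates of all $w_j$ are real, and the vectors $w_0, \dots, w_n$, regarded as points of $\mathbf{R}^n$, are the vertices of a (nondegenerate) $n$-simplex all of whose edge lengths are equal. Let $u_j, v_j$ be the associated real vectors of $w_j$ and $\ddot V = \{u_0, \dots, u_n, v_0, \dots, v_n\} \subset \mathbf{R}^{2n}$. Then $\operatorname{conv}(\ddot V)$ is a convex polytope with exactly $2n+2$ vertices inscribed in the unit sphere $S^{2n-1} \subset \mathbf{R}^{2n}$ centred at $0$ (that is, all its vertices lie on $S^{2n-1}$), and its $2n$-dimensional volume is maximal among all such polytopes: for every convex polytope $P \subset \mathbf{R}^{2n}$ with exactly $2n+2$ vertices, all lying on $S^{2n-1}$, we have $$\operatorname{vol}(P)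 \le \operatorname{vol}(\operatorname{conv}(\ddot V)).$$ -/

import Mathlib

open MeasureTheory

/-- The real part `[x₁, …, xₙ]ᵀ` of a vector `w = [x₁ + i y₁, …, xₙ + i yₙ]ᵀ` of `ℂⁿ`. -/
def realPartVec {n : ℕ} (w : EuclideanSpace ℂ (Fin n)) : EuclideanSpace ℝ (Fin n) :=
  WithLp.toLp 2 fun k => (w k).re

/-- The associated real vector `u = [x₁, …, xₙ, y₁, …, yₙ]ᵀ` of `w`. -/
def assocU {n : ℕ} (w : EuclideanSpace ℂ (Fin n)) : EuclideanSpace ℝ (Fin (n + n)) :=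
  WithLp.toLp 2 (Fin.append (fun k => (w k).re) (fun k => (w k).im))

/-- The associated real vector `v = [-y₁, …, -yₙ, x₁, …, xₙ]ᵀ` of `w`. -/
def assocV {n : ℕ} (w : EuclideanSpace ℂ (Fin n)) : EuclideanSpace ℝ (Fin (n + n)) :=
  WithLp.toLp 2 (Fin.append (fun k => -(w k).im) (fun k => (w k).re))

/-- The set of all associated real vectors of the vectors of `V`. -/
def assocRealVectors {n : ℕ} (V : Set (EuclideanSpace ℂ (Fin n))) :
    Set (EuclideanSpace ℝ (Fin (n + n))) :=
  assocU '' V ∪ assocV '' V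

/-- `V ⊆ ℂⁿ` is the vertex set of a real regular simplex: all vectors of `V` have real coordinates,
and their real parts are the vertices of an `n`-simplex in `ℝⁿ` all of whose edge lengths are
equal. -/
def IsRealRegularSimplexVertexSet {n : ℕ} (V : Set (EuclideanSpace ℂ (Fin n))) : Prop :=
  (∀ w ∈ V, ∀ k, (w k).im = 0) ∧
    ∃ s : Affine.Simplex ℝ (EuclideanSpace ℝ (Fin n)) n,
      s.Equilateral ∧ Set.range s.points = realPartVec '' V

/-- `P ⊆ ℝᵈ` is a convex polytope (the convex hull of a finite set) with exactly `m` vertices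
(extreme points), inscribed in the unit sphere centred at `0` (all vertices lie on it). -/
def IsInscribedPolytope {d : ℕ} (m : ℕ) (P : Set (EuclideanSpace ℝ (Fin d))) : Prop :=
  (∃ F : Finset (EuclideanSpace ℝ (Fin d)),
      P = convexHull ℝ (F : Set (EuclideanSpace ℝ (Fin d)))) ∧
    (P.extremePoints ℝ).ncard = m ∧
    P.extremePoints ℝ ⊆ Metric.sphere 0 1

/-!
Put `d = 2n`. Any `d + 2` points `p i` of `ℝᵈ` have an affine dependence `∑ a i • p i = 0`,
`∑ a i = 0`; let `S` be the set of indices with `a i > 0`. The simplices spanned by all points but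
one, the omitted one running through `S`, cover the convex hull
(`convexHull_range_eq_biUnion`), and overlap in null sets when the dependence is unique. Their
volumes are proportional to `a i`, and by row operations their sum is, up to a constant depending
only on `d`, the absolute value of the determinant with rows `(1_S i, 1, p i)`
(`sum_ofReal_facets`). So this determinant bounds the volume (`volume_convexHull_le`), with equality
when it is nonzero (`volume_convexHull_eq`). The constant, the volume of the corner simplex, never
has to be computed.

Column operations turn the rows into `(s 1_S i, s 1_{Sᶜ} i, p i)` at the cost of a factor `s²`.
For unit vectors `p i` all these rows have squared norm `1 + s²`, so Hadamard's inequality bounds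
the determinant by `(1 + s²)^((d + 2) / 2)`, whatever `S` is (`sq_det_balancedMatrix_le`). Equality
holds when the rows are orthogonal, that is, when points on the same side of the dependence have
inner product `-s²` and points on different sides are orthogonal. With `s² = 1/n` this is what
happens for two regular `n`-simplices inscribed in the unit spheres of two orthogonal copies of
`ℝⁿ` (`inner_eq_neg_inv_of_equilateral`), which is the configuration in question.
-/

/-! ### Volume of a simplex -/

theorem mem_convexHull_range_iff {ι E : Type*} [Fintype ι] [AddCommGroup E] [Module ℝ E]
    {p : ι → E} {x : E} :
    x ∈ convexHull ℝ (Set.range p) ↔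
      ∃ w : ι → ℝ, (∀ i, 0 ≤ w i) ∧ ∑ i, w i = 1 ∧ ∑ i, w i • p i = x := by
  constructor
  · intro hx
    have := convexHull_range_eq_exists_affineCombination (R := ℝ) p
    rw [this] at hx
    obtain ⟨s, w, h0, h1, rfl⟩ := hx
    classical
    refine ⟨fun i => if i ∈ s then w i else 0, fun i => ?_, by simpa using h1, ?_⟩
    · dsimp only
      split_ifs with h
      exacts [h0 i h, le_rfl]
    · rw [s.affineCombination_eq_linear_combination p w h1]
      simp [ite_smul]
  · rintro ⟨w, h0, h1, rfl⟩
    exact mem_convexHull_of_exists_fintype w p h0 h1 (fun i => Set.mem_range_self i) rfl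

/-- The square matrix with rows `(1, q j)`; up to a dimensional constant, its determinant is the
signed volume of the simplex with vertices `q j`. -/
def simplexMatrix {d : ℕ} (q : Fin (d + 1) → EuclideanSpace ℝ (Fin d)) :
    Matrix (Fin (d + 1)) (Fin (d + 1)) ℝ :=
  Matrix.of fun j => Fin.cons 1 (q j).ofLp

/-- The volume of the corner simplex spanned by `0` and the standard basis vectors. -/
noncomputable def cornerVolume (d : ℕ) : ENNReal :=
  volume (convexHull ℝ (Set.range
    (Fin.cons 0 (fun i => EuclideanSpace.single i 1) : Fin (d + 1) → EuclideanSpace ℝ (Fin d))))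

theorem det_simplexMatrix {d : ℕ} (q : Fin (d + 1) → EuclideanSpace ℝ (Fin d)) :
    (simplexMatrix q).det = (Matrix.of fun i j => (q (Fin.succ i) - q 0) j).det := by
  rw [Matrix.det_eq_of_forall_row_eq_smul_add_const (A := simplexMatrix q)
    (B := Matrix.of (Fin.cons (Fin.cons 1 (q 0).ofLp)
      (fun i => Fin.cons 0 (q (Fin.succ i) - q 0).ofLp)))
    (Fin.cons 0 (fun _ => 1)) 0 rfl]
  · rw [Matrix.det_succ_column_zero, Fin.sum_univ_succ]
    simp only [Matrix.of_apply, Fin.cons_zero, Fin.cons_succ]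
    simp
    rfl
  · intro i j
    refine Fin.cases ?_ (fun i => ?_) i <;> refine Fin.cases ?_ (fun j => ?_) j <;>
      simp [simplexMatrix]

/-- Every simplex is an affine image of the corner simplex. -/
theorem volume_convexHull_simplex {d : ℕ} (q : Fin (d + 1) → EuclideanSpace ℝ (Fin d)) :
    volume (convexHull ℝ (Set.range q)) =
      ENNReal.ofReal |(simplexMatrix q).det| * cornerVolume d := by
  set M : Matrix (Fin d) (Fin d) ℝ := Matrix.of fun i j => (q (Fin.succ i) - q 0) j with hM
  set f : EuclideanSpace ℝ (Fin d) →ₗ[ℝ] EuclideanSpace ℝ (Fin d) :=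
    Matrix.toLpLin 2 2 M.transpose with hf
  have hdet : LinearMap.det f = (simplexMatrix q).det := by
    rw [det_simplexMatrix, hf, Matrix.toLpLin_eq_toLin, LinearMap.det_toLin,
      Matrix.det_transpose]
  set c : Fin (d + 1) → EuclideanSpace ℝ (Fin d) :=
    Fin.cons 0 (fun i => EuclideanSpace.single i 1) with hc
  have hq : Set.range q = (fun x => q 0 + x) '' (f '' Set.range c) := by
    rw [← Set.range_comp, ← Set.range_comp]
    congr 1
    funext i
    refine Fin.cases ?_ (fun i => ?_) i
    · simp [c]
    · ext k
      simp [c, f, M, Matrix.toLpLin_apply]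
  have h2 : convexHull ℝ (Set.range q) =
      (fun x => q 0 + x) '' (f '' convexHull ℝ (Set.range c)) := by
    rw [hq, f.image_convexHull]
    have := convexHull_vadd (𝕜 := ℝ) (q 0) (f '' Set.range c)
    simpa [← Set.image_vadd] using this
  rw [h2, Set.image_add_left, measure_preimage_add, Measure.addHaar_image_linearMap, hdet]
  rfl

/-! ### Volume of the convex hull of `d + 2` points -/

/-- The matrix whose `i`-th row is `(1_S i, 1, p i)`. If `S` is the positive part of an affine
dependence of the points `p i`, then its determinant is, up to sign and a dimensional constant, the
volume of their convex hull. -/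
def circuitMatrix {d : ℕ} (S : Finset (Fin (d + 2)))
    (p : Fin (d + 2) → EuclideanSpace ℝ (Fin d)) : Matrix (Fin (d + 2)) (Fin (d + 2)) ℝ :=
  Matrix.of fun i => Fin.cons (if i ∈ S then 1 else 0) (Fin.cons 1 (p i).ofLp)

theorem sum_smul_circuitMatrix {d : ℕ} (S : Finset (Fin (d + 2)))
    (p : Fin (d + 2) → EuclideanSpace ℝ (Fin d)) (a : Fin (d + 2) → ℝ)
    (ha : ∑ i, a i = 0) (hap : ∑ i, a i • p i = 0) :
    ∑ i, a i • circuitMatrix S p i = Fin.cons (∑ i ∈ S, a i) 0 := by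
  funext j
  rw [Finset.sum_apply]
  refine Fin.cases ?_ (fun j => Fin.cases ?_ (fun j => ?_) j) j
  · simp [circuitMatrix]
  · simpa [circuitMatrix] using ha
  · have := congrArg (fun x : EuclideanSpace ℝ (Fin d) => x j) hap
    simpa [circuitMatrix] using this

/-- Replacing row `i` of `circuitMatrix S p` by the combination of all rows with the coefficients
of an affine dependence leaves only the minor that belongs to the points other than `p i`. -/
theorem abs_mul_det_circuitMatrix {d : ℕ} (S : Finset (Fin (d + 2)))
    (p : Fin (d + 2) → EuclideanSpace ℝ (Fin d)) (a : Fin (d + 2) → ℝ)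
    (ha : ∑ i, a i = 0) (hap : ∑ i, a i • p i = 0) (i : Fin (d + 2)) :
    |a i| * |(circuitMatrix S p).det| =
      |∑ k ∈ S, a k| * |(simplexMatrix (p ∘ i.succAbove)).det| := by
  have h := Matrix.det_updateRow_sum (circuitMatrix S p) i a
  rw [sum_smul_circuitMatrix S p a ha hap, Matrix.det_succ_row _ i, Fin.sum_univ_succ] at h
  simp only [Matrix.updateRow_self, Fin.cons_zero, Fin.cons_succ, Pi.zero_apply, mul_zero,
    zero_mul, Finset.sum_const_zero, add_zero, Fin.succAbove_zero, smul_eq_mul] at h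
  have hs : ((circuitMatrix S p).updateRow i (Fin.cons (∑ k ∈ S, a k) 0)).submatrix
      i.succAbove Fin.succ = simplexMatrix (p ∘ i.succAbove) := by
    ext k l
    simp [Matrix.updateRow_apply, circuitMatrix, simplexMatrix]
  rw [hs] at h
  rw [← abs_mul, ← h, abs_mul, abs_mul, abs_pow, abs_neg, abs_one, one_pow, one_mul]

/-- The convex hull of `d + 2` points is covered by the simplices obtained by omitting one point
of the positive part `S` of an affine dependence. -/
theorem convexHull_range_eq_biUnion {d : ℕ} {E : Type*} [AddCommGroup E] [Module ℝ E]
    (p : Fin (d + 2) → E) (a : Fin (d + 2) → ℝ)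
    (ha : ∑ i, a i = 0) (hap : ∑ i, a i • p i = 0) (S : Finset (Fin (d + 2)))
    (hS : ∀ i, i ∈ S ↔ 0 < a i) (hne : S.Nonempty) :
    convexHull ℝ (Set.range p) =
      ⋃ i ∈ S, convexHull ℝ (Set.range (p ∘ i.succAbove)) := by
  apply Set.Subset.antisymm
  · intro x hx
    obtain ⟨w, h0, h1, rfl⟩ := mem_convexHull_range_iff.1 hx
    -- subtract the largest multiple of the dependence that keeps all the weights nonnegative
    obtain ⟨i, hi, hmin⟩ := S.exists_min_image (fun i => w i / a i) hne
    have hai := (hS i).1 hi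
    set t := w i / a i with ht
    have ht0 : 0 ≤ t := div_nonneg (h0 i) hai.le
    have hwi : w i - t * a i = 0 := by rw [ht]; field_simp; ring
    refine Set.mem_biUnion hi (mem_convexHull_range_iff.2
      ⟨fun k => w (i.succAbove k) - t * a (i.succAbove k), fun k => ?_, ?_, ?_⟩)
    · rcases lt_or_ge 0 (a (i.succAbove k)) with h | h
      · have := hmin _ ((hS _).2 h)
        rw [le_div_iff₀ h] at this
        linarith
      · nlinarith [h0 (i.succAbove k)]
    · have : ∑ k, (w k - t * a k) = 1 := by
        rw [Finset.sum_sub_distrib, ← Finset.mul_sum, ha, h1]; ring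
      rwa [Fin.sum_univ_succAbove _ i, hwi, zero_add] at this
    · have : ∑ k, (w k - t * a k) • p k = ∑ k, w k • p k := by
        simp only [sub_smul, Finset.sum_sub_distrib, mul_smul]
        rw [← Finset.smul_sum, hap]; simp
      rwa [Fin.sum_univ_succAbove _ i, hwi, zero_smul, zero_add] at this
  · exact Set.iUnion₂_subset fun i _ => convexHull_mono (Set.range_comp_subset_range _ _)

theorem volume_convexHull_image_eq_zero {d : ℕ} {ι : Type*} [DecidableEq ι]
    (p : ι → EuclideanSpace ℝ (Fin d)) (s : Finset ι) (hs : s.card ≤ d) :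
    volume (convexHull ℝ (p '' s)) = 0 := by
  classical
  rcases s.eq_empty_or_nonempty with rfl | hne
  · simp
  refine measure_mono_null (convexHull_subset_affineSpan _)
    (Measure.addHaar_affineSubspace _ _ fun htop => ?_)
  have h1 := finrank_vectorSpan_image_finset_le ℝ p s (n := s.card - 1)
    (by have := hne.card_pos; omega)
  have h2 := congrArg AffineSubspace.direction htop
  rw [direction_affineSpan, AffineSubspace.direction_top] at h2
  rw [Finset.coe_image, h2, finrank_top, finrank_euclideanSpace_fin] at h1
  have := hne.card_pos
  omega

/-- The simplices that omit a point of `S` have volumes proportional to the coefficients of the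
affine dependence, hence their total volume is a single determinant. -/
theorem sum_ofReal_facets {d : ℕ} (p : Fin (d + 2) → EuclideanSpace ℝ (Fin d))
    (a : Fin (d + 2) → ℝ)
    (ha : ∑ i, a i = 0) (hap : ∑ i, a i • p i = 0) (S : Finset (Fin (d + 2)))
    (hS : ∀ i, i ∈ S ↔ 0 < a i) (hne : S.Nonempty) :
    ∑ i ∈ S, volume (convexHull ℝ (Set.range (p ∘ i.succAbove))) =
      ENNReal.ofReal |(circuitMatrix S p).det| * cornerVolume d := by
  simp only [volume_convexHull_simplex]
  rw [← Finset.sum_mul, ← ENNReal.ofReal_sum_of_nonneg fun _ _ => abs_nonneg _]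
  congr 2
  have hpos : 0 < ∑ k ∈ S, a k := Finset.sum_pos (fun i hi => (hS i).1 hi) hne
  apply mul_left_cancel₀ hpos.ne'
  rw [Finset.mul_sum, Finset.sum_mul]
  refine Finset.sum_congr rfl fun i hi => ?_
  have := abs_mul_det_circuitMatrix S p a ha hap i
  rw [abs_of_pos hpos, abs_of_pos ((hS i).1 hi)] at this
  exact this.symm

theorem volume_convexHull_le {d : ℕ} (p : Fin (d + 2) → EuclideanSpace ℝ (Fin d))
    (a : Fin (d + 2) → ℝ)
    (ha : ∑ i, a i = 0) (hap : ∑ i, a i • p i = 0) (S : Finset (Fin (d + 2)))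
    (hS : ∀ i, i ∈ S ↔ 0 < a i) (hne : S.Nonempty) :
    volume (convexHull ℝ (Set.range p)) ≤
      ENNReal.ofReal |(circuitMatrix S p).det| * cornerVolume d := by
  rw [← sum_ofReal_facets p a ha hap S hS hne,
    convexHull_range_eq_biUnion p a ha hap S hS hne]
  exact measure_biUnion_finset_le _ _

/-- If `det (circuitMatrix S p) ≠ 0`, the affine dependence is unique up to scaling, so two of the
simplices that cover the convex hull meet in the convex hull of at most `d` points. -/
theorem aedisjoint_facets {d : ℕ} (p : Fin (d + 2) → EuclideanSpace ℝ (Fin d))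
    (a : Fin (d + 2) → ℝ)
    (ha : ∑ i, a i = 0) (hap : ∑ i, a i • p i = 0) (S : Finset (Fin (d + 2)))
    (hS : ∀ i, i ∈ S ↔ 0 < a i) (hdet : (circuitMatrix S p).det ≠ 0) {i j : Fin (d + 2)}
    (hi : i ∈ S) (hj : j ∈ S) (hij : i ≠ j) :
    AEDisjoint volume (convexHull ℝ (Set.range (p ∘ i.succAbove)))
      (convexHull ℝ (Set.range (p ∘ j.succAbove))) := by
  have key : ∀ (i : Fin (d + 2)) (x : EuclideanSpace ℝ (Fin d)),
      x ∈ convexHull ℝ (Set.range (p ∘ i.succAbove)) → ∃ w : Fin (d + 2) → ℝ,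
        (∀ k, 0 ≤ w k) ∧ ∑ k, w k = 1 ∧ ∑ k, w k • p k = x ∧ w i = 0 := by
    intro i x hx
    obtain ⟨w, h0, h1, rfl⟩ := mem_convexHull_range_iff.1 hx
    refine ⟨i.insertNth 0 w, fun k => ?_, ?_, ?_, by simp⟩
    · refine i.succAboveCases ?_ (fun k => ?_) k <;> simp [h0]
    · simp [Fin.sum_univ_succAbove _ i, h1]
    · simp [Fin.sum_univ_succAbove _ i]
  refine measure_mono_null (t := convexHull ℝ (p '' (({i, j}ᶜ : Finset (Fin (d + 2))) : Set _)))
    ?_ (volume_convexHull_image_eq_zero p _ ?_)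
  swap
  · rw [Finset.card_compl, Finset.card_pair hij]; simp
  rintro x ⟨hx1, hx2⟩
  obtain ⟨w, w0, w1, wx, wi⟩ := key i x hx1
  obtain ⟨v, v0, v1, vx, vj⟩ := key j x hx2
  have hpos : 0 < ∑ k ∈ S, a k := Finset.sum_pos (fun i hi => (hS i).1 hi) ⟨i, hi⟩
  set s := ∑ k ∈ S, a k with hs
  set b : Fin (d + 2) → ℝ := fun k => w k - v k with hb
  have hb0 : ∑ k, b k = 0 := by simp [b, Finset.sum_sub_distrib, w1, v1]
  have hbp : ∑ k, b k • p k = 0 := by simp [b, sub_smul, Finset.sum_sub_distrib, wx, vx]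
  set r := ∑ k ∈ S, b k with hr
  have hv : (s • b - r • a) = 0 := by
    apply Matrix.eq_zero_of_vecMul_eq_zero hdet
    have h1 := sum_smul_circuitMatrix S p a ha hap
    have h2 := sum_smul_circuitMatrix S p b hb0 hbp
    rw [Matrix.sub_vecMul, Matrix.smul_vecMul, Matrix.smul_vecMul, Matrix.vecMul_eq_sum,
      Matrix.vecMul_eq_sum]
    change s • (∑ k, b k • circuitMatrix S p k) - r • (∑ k, a k • circuitMatrix S p k) = 0
    rw [h1, h2]
    funext k
    refine Fin.cases ?_ (fun k => ?_) k
    · simp [← hs, ← hr, mul_comm]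
    · simp
  have hv' : ∀ k, s * (w k - v k) = r * a k := fun k => by
    have := congrFun hv k
    simp only [Pi.sub_apply, Pi.smul_apply, smul_eq_mul, Pi.zero_apply, b] at this
    linarith
  have hai := (hS i).1 hi
  have haj := (hS j).1 hj
  have hr0 : r = 0 := by
    apply le_antisymm
    · have := hv' i
      rw [wi] at this
      nlinarith [mul_nonneg hpos.le (v0 i)]
    · have := hv' j
      rw [vj] at this
      nlinarith [mul_nonneg hpos.le (w0 j)]
  have wj : w j = 0 := by
    have := hv' j
    rw [hr0, vj, zero_mul, sub_zero] at this
    exact (mul_eq_zero.1 this).resolve_left hpos.ne'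
  have hsub : ∀ k, k ∉ ({i, j}ᶜ : Finset (Fin (d + 2))) → w k = 0 := by
    intro k hk
    simp only [Finset.mem_compl, Finset.mem_insert, Finset.mem_singleton, not_not] at hk
    rcases hk with rfl | rfl <;> assumption
  rw [← wx, ← Finset.sum_subset (Finset.subset_univ ({i, j}ᶜ))
    fun k _ hk => by rw [hsub k hk, zero_smul]]
  refine (convex_convexHull ℝ _).sum_mem (fun k _ => w0 k) ?_ fun k hk =>
    subset_convexHull ℝ _ (Set.mem_image_of_mem _ hk)
  rw [Finset.sum_subset (Finset.subset_univ ({i, j}ᶜ)) fun k _ hk => hsub k hk, w1]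

/-- Equality in `volume_convexHull_le`: the covering simplices form a triangulation. -/
theorem volume_convexHull_eq {d : ℕ} (p : Fin (d + 2) → EuclideanSpace ℝ (Fin d))
    (a : Fin (d + 2) → ℝ)
    (ha : ∑ i, a i = 0) (hap : ∑ i, a i • p i = 0) (S : Finset (Fin (d + 2)))
    (hS : ∀ i, i ∈ S ↔ 0 < a i) (hne : S.Nonempty) (hdet : (circuitMatrix S p).det ≠ 0) :
    volume (convexHull ℝ (Set.range p)) =
      ENNReal.ofReal |(circuitMatrix S p).det| * cornerVolume d := by
  rw [← sum_ofReal_facets p a ha hap S hS hne,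
    convexHull_range_eq_biUnion p a ha hap S hS hne]
  refine measure_biUnion_finset₀ (fun i hi j hj hij => ?_) fun i _ => ?_
  · exact aedisjoint_facets p a ha hap S hS hdet hi hj hij
  · exact ((Set.finite_range _).isCompact_convexHull ℝ).measurableSet.nullMeasurableSet

/-! ### The determinant bound -/

/-- Hadamard's inequality. -/
theorem sq_det_le_prod_sum_sq {N : ℕ} (A : Matrix (Fin N) (Fin N) ℝ) :
    A.det ^ 2 ≤ ∏ i, ∑ j, A i j ^ 2 := by
  have : Fact (Module.finrank ℝ (EuclideanSpace ℝ (Fin N)) = N) := ⟨by simp⟩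
  set b := EuclideanSpace.basisFun (Fin N) ℝ with hb
  have h := b.toBasis.orientation.abs_volumeForm_apply_le fun i => WithLp.toLp 2 (A i)
  rw [Orientation.volumeForm_robust _ b rfl, Module.Basis.det_apply] at h
  have hA : b.toBasis.toMatrix (fun i => WithLp.toLp 2 (A i)) = A.transpose := by
    ext i j
    simp [Module.Basis.toMatrix_apply, b]
  rw [hA, Matrix.det_transpose] at h
  rw [← sq_abs]
  refine (pow_le_pow_left₀ (abs_nonneg _) h 2).trans_eq ?_
  rw [← Finset.prod_pow]
  simp [EuclideanSpace.norm_sq_eq]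

/-- The matrix whose `i`-th row is `(s 1_S i, s 1_{Sᶜ} i, p i)`. It is `circuitMatrix S p` after
column operations; if the points `p i` are unit vectors, its rows have equal norms. -/
def balancedMatrix {d : ℕ} (s : ℝ) (S : Finset (Fin (d + 2)))
    (p : Fin (d + 2) → EuclideanSpace ℝ (Fin d)) : Matrix (Fin (d + 2)) (Fin (d + 2)) ℝ :=
  Matrix.of fun i => Fin.cons (if i ∈ S then s else 0)
    (Fin.cons (if i ∈ S then 0 else s) (p i).ofLp)

theorem det_balancedMatrix {d : ℕ} (s : ℝ) (S : Finset (Fin (d + 2)))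
    (p : Fin (d + 2) → EuclideanSpace ℝ (Fin d)) :
    (balancedMatrix s S p).det = s ^ 2 * (circuitMatrix S p).det := by
  have h1 : balancedMatrix s S p = Matrix.of fun i j =>
      (Fin.cons s (Fin.cons s 1) : Fin (d + 2) → ℝ) j * balancedMatrix 1 S p i j := by
    ext i j
    refine Fin.cases ?_ (fun j => Fin.cases ?_ (fun j => ?_) j) j <;> simp [balancedMatrix]
  have h2 : (circuitMatrix S p).det = (balancedMatrix 1 S p).det := by
    rw [← Matrix.det_transpose, ← Matrix.det_transpose (balancedMatrix 1 S p)]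
    refine Matrix.det_eq_of_forall_row_eq_smul_add_const (Fin.cons 0 (Fin.cons 1 0)) 0 rfl ?_
    intro j i
    refine Fin.cases ?_ (fun j => Fin.cases ?_ (fun j => ?_) j) j <;>
      simp [balancedMatrix, circuitMatrix]
    split_ifs <;> simp
  rw [h1, Matrix.det_mul_row, ← h2]
  congr 1
  simp [Fin.prod_univ_succ, sq]

theorem sum_sq_balancedMatrix {d : ℕ} (s : ℝ) (S : Finset (Fin (d + 2)))
    (p : Fin (d + 2) → EuclideanSpace ℝ (Fin d)) (i : Fin (d + 2)) :
    ∑ j, balancedMatrix s S p i j ^ 2 = s ^ 2 + ‖p i‖ ^ 2 := by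
  rw [Fin.sum_univ_succ, Fin.sum_univ_succ, EuclideanSpace.norm_sq_eq]
  simp only [balancedMatrix, Matrix.of_apply, Fin.cons_zero, Fin.cons_succ, Real.norm_eq_abs,
    sq_abs]
  split_ifs <;> ring

/-- Hadamard's inequality for unit vectors. The bound does not depend on `S`, so the sizes of the
two parts of the affine dependence play no role. -/
theorem sq_det_balancedMatrix_le {d : ℕ} (s : ℝ) (S : Finset (Fin (d + 2)))
    (p : Fin (d + 2) → EuclideanSpace ℝ (Fin d)) (hp : ∀ i, ‖p i‖ = 1) :
    (balancedMatrix s S p).det ^ 2 ≤ (s ^ 2 + 1) ^ (d + 2) := by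
  refine (sq_det_le_prod_sum_sq _).trans_eq ?_
  simp [sum_sq_balancedMatrix, hp]

/-- Equality in Hadamard's inequality: the inner products are those that make the rows of
`balancedMatrix s S p` orthogonal. -/
theorem sq_det_balancedMatrix_eq {d : ℕ} (s : ℝ) (S : Finset (Fin (d + 2)))
    (p : Fin (d + 2) → EuclideanSpace ℝ (Fin d)) (hp : ∀ i, ‖p i‖ = 1)
    (hinner : ∀ i j, i ≠ j → inner ℝ (p i) (p j) = if (i ∈ S ↔ j ∈ S) then -s ^ 2 else 0) :
    (balancedMatrix s S p).det ^ 2 = (s ^ 2 + 1) ^ (d + 2) := by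
  have h : balancedMatrix s S p * (balancedMatrix s S p).transpose =
      Matrix.diagonal fun _ => s ^ 2 + 1 := by
    ext i j
    rcases eq_or_ne i j with rfl | hij
    · have := sum_sq_balancedMatrix s S p i
      simp only [sq, hp] at this
      simp [Matrix.mul_apply, this, sq]
    · rw [Matrix.diagonal_apply_ne _ hij, Matrix.mul_apply, Fin.sum_univ_succ, Fin.sum_univ_succ]
      have hin := hinner i j hij
      rw [PiLp.inner_apply] at hin
      simp only [RCLike.inner_apply, conj_trivial] at hin
      have hin' : ∑ k, p i k * p j k = if (i ∈ S ↔ j ∈ S) then -s ^ 2 else 0 := by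
        rw [← hin]; exact Finset.sum_congr rfl fun _ _ => mul_comm _ _
      simp only [balancedMatrix, Matrix.transpose_apply, Matrix.of_apply, Fin.cons_zero,
        Fin.cons_succ, hin']
      by_cases hi : i ∈ S <;> by_cases hj : j ∈ S <;> simp [hi, hj] <;> ring
  have := congrArg Matrix.det h
  rw [Matrix.det_mul, Matrix.det_transpose, Matrix.det_diagonal] at this
  simpa [sq] using this

theorem exists_affine_dependence {d : ℕ} (p : Fin (d + 2) → EuclideanSpace ℝ (Fin d)) :
    ∃ a : Fin (d + 2) → ℝ, ∑ i, a i = 0 ∧ ∑ i, a i • p i = 0 ∧ ∃ i, 0 < a i := by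
  have h : ¬ LinearIndependent ℝ fun i => ((1 : ℝ), p i) := fun h => by
    have := h.fintype_card_le_finrank
    simp at this
    omega
  obtain ⟨a, ha, i, hi⟩ := Fintype.not_linearIndependent_iff.1 h
  have h1 := congrArg Prod.fst ha
  have h2 := congrArg Prod.snd ha
  simp only [Prod.fst_sum, Prod.snd_sum, Prod.smul_fst, Prod.smul_snd, smul_eq_mul, mul_one,
    Prod.fst_zero, Prod.snd_zero] at h1 h2
  obtain ⟨j, -, hj⟩ := Finset.exists_pos_of_sum_zero_of_exists_nonzero a h1
    ⟨i, Finset.mem_univ i, hi⟩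
  exact ⟨a, h1, h2, j, hj⟩

/-- A family of unit vectors that attains equality in Hadamard's inequality spans the largest
volume among all families of `d + 2` unit vectors. -/
theorem volume_convexHull_le_of_inner_eq {d : ℕ} {s : ℝ} (hs : s ≠ 0)
    (p : Fin (d + 2) → EuclideanSpace ℝ (Fin d)) (hp : ∀ i, ‖p i‖ = 1)
    (a : Fin (d + 2) → ℝ)
    (ha : ∑ i, a i = 0) (hap : ∑ i, a i • p i = 0) (S : Finset (Fin (d + 2)))
    (hS : ∀ i, i ∈ S ↔ 0 < a i) (hne : S.Nonempty)
    (hinner : ∀ i j, i ≠ j → inner ℝ (p i) (p j) = if (i ∈ S ↔ j ∈ S) then -s ^ 2 else 0)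
    (q : Fin (d + 2) → EuclideanSpace ℝ (Fin d)) (hq : ∀ i, ‖q i‖ = 1) :
    volume (convexHull ℝ (Set.range q)) ≤ volume (convexHull ℝ (Set.range p)) := by
  have hpe := sq_det_balancedMatrix_eq s S p hp hinner
  have hdet : (circuitMatrix S p).det ≠ 0 := fun h0 => by
    rw [det_balancedMatrix, h0] at hpe
    have : 0 < (s ^ 2 + 1) ^ (d + 2) := by positivity
    simp at hpe
    linarith
  obtain ⟨b, hb, hbq, i, hi⟩ := exists_affine_dependence q
  set T : Finset (Fin (d + 2)) := Finset.univ.filter fun i => 0 < b i with hT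
  have hle := sq_det_balancedMatrix_le s T q hq
  rw [volume_convexHull_eq p a ha hap S hS hne hdet]
  refine (volume_convexHull_le q b hb hbq T (by simp [T]) ⟨i, by simp [T, hi]⟩).trans ?_
  gcongr ENNReal.ofReal ?_ * _
  rw [← hpe, det_balancedMatrix, det_balancedMatrix, sq_le_sq, abs_mul, abs_mul] at hle
  exact le_of_mul_le_mul_left hle (abs_pos.2 (pow_ne_zero 2 hs))

/-- The vertices of a regular simplex inscribed in the unit sphere have sum `0` and pairwise inner
products `-1/n`. -/
theorem inner_eq_neg_inv_of_equilateral {n : ℕ} (hn : n ≠ 0)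
    (s : Affine.Simplex ℝ (EuclideanSpace ℝ (Fin n)) n) (hs : s.Equilateral)
    (h1 : ∀ i, ‖s.points i‖ = 1) :
    (∑ i, s.points i = 0) ∧
      ∀ i j, i ≠ j → inner ℝ (s.points i) (s.points j) = -(n : ℝ)⁻¹ := by
  obtain ⟨r, hr⟩ := hs
  have hself : ∀ i, inner ℝ (s.points i) (s.points i) = (1 : ℝ) := fun i => by
    rw [real_inner_self_eq_norm_sq, h1, one_pow]
  set c : ℝ := 1 - r ^ 2 / 2 with hc
  have hin : ∀ i j, i ≠ j → inner ℝ (s.points i) (s.points j) = c := fun i j hij => by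
    have h2 := norm_sub_sq_real (s.points i) (s.points j)
    rw [← dist_eq_norm, hr i j hij, h1, h1] at h2
    rw [hc]; linarith
  have hc1 : 1 - c ≠ 0 := by
    have h01 : (0 : Fin (n + 1)) ≠ Fin.last n := by
      intro h; exact hn (by simpa using (congrArg Fin.val h).symm)
    have : r ≠ 0 := by
      rw [← hr _ _ h01]
      exact dist_ne_zero.2 (s.independent.injective.ne h01)
    rw [hc]
    intro h
    exact pow_ne_zero 2 this (by linarith)
  have hsum : ∀ (g : Fin (n + 1) → ℝ) j,
      inner ℝ (∑ i, g i • s.points i) (s.points j) = (1 - c) * g j + c * ∑ i, g i := by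
    intro g j
    rw [sum_inner, Fin.sum_univ_succAbove _ j, Fin.sum_univ_succAbove g j]
    have : ∀ k, inner ℝ (g (j.succAbove k) • s.points (j.succAbove k)) (s.points j) =
        g (j.succAbove k) * c := fun k => by
      rw [real_inner_smul_left, hin _ _ (Fin.succAbove_ne j k)]
    simp only [this]
    rw [real_inner_smul_left, hself, ← Finset.sum_mul]
    ring
  -- `n + 1` vectors of `ℝⁿ` are dependent, and the symmetry makes all coefficients equal
  have hdep : ¬ LinearIndependent ℝ s.points := fun h => by
    have := h.fintype_card_le_finrank
    simp at this
  obtain ⟨g, hg, i₀, hi₀⟩ := Fintype.not_linearIndependent_iff.1 hdep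
  have hconst : ∀ j, g j = g i₀ := fun j => by
    have h2 := hsum g j
    have h3 := hsum g i₀
    rw [hg, inner_zero_left] at h2 h3
    exact mul_left_cancel₀ hc1 (by linarith)
  have hzero : ∑ i, s.points i = 0 := by
    simp only [hconst, ← Finset.smul_sum] at hg
    exact (smul_eq_zero.1 hg).resolve_left hi₀
  refine ⟨hzero, fun i j hij => ?_⟩
  rw [hin i j hij]
  have h2 := hsum (fun _ => 1) i
  simp only [one_smul, hzero, inner_zero_left, Finset.sum_const, Finset.card_univ,
    Fintype.card_fin, nsmul_eq_mul, mul_one] at h2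
  push_cast at h2
  have hn' : (n : ℝ) ≠ 0 := Nat.cast_ne_zero.2 hn
  field_simp
  linarith

/-! ### Inscribed polytopes -/

theorem extremePoints_convexHull_of_subset_sphere {E : Type*} [NormedAddCommGroup E]
    [NormedSpace ℝ E] [StrictConvexSpace ℝ E] {s : Set E} (hs : s ⊆ Metric.sphere 0 1) :
    (convexHull ℝ s).extremePoints ℝ = s := by
  refine extremePoints_convexHull_subset.antisymm fun x hx => ?_
  have hsub : convexHull ℝ s ⊆ Metric.closedBall 0 1 :=
    convexHull_min (hs.trans Metric.sphere_subset_closedBall) (convex_closedBall 0 1)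
  exact inter_extremePoints_subset_extremePoints_of_subset hsub ⟨subset_convexHull ℝ s hx,
    StrictConvexSpace.sphere_subset_extremePoints_closedBall 0 one_ne_zero (hs hx)⟩

/-- By Krein–Milman, an inscribed polytope is the convex hull of its vertices. -/
theorem IsInscribedPolytope.exists_eq_convexHull_range {d m : ℕ}
    {P : Set (EuclideanSpace ℝ (Fin d))} (h : IsInscribedPolytope m P) :
    ∃ q : Fin m → EuclideanSpace ℝ (Fin d), (∀ i, ‖q i‖ = 1) ∧
      P = convexHull ℝ (Set.range q) := by
  obtain ⟨⟨F, rfl⟩, hcard, hsph⟩ := h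
  have hfin : ((convexHull ℝ (F : Set _)).extremePoints ℝ).Finite :=
    F.finite_toSet.subset extremePoints_convexHull_subset
  have hKM := closure_convexHull_extremePoints (F.finite_toSet.isCompact_convexHull ℝ)
    (convex_convexHull ℝ (F : Set (EuclideanSpace ℝ (Fin d))))
  rw [(hfin.isCompact_convexHull ℝ).isClosed.closure_eq] at hKM
  have := hfin.fintype
  rw [Set.ncard_eq_toFinset_card', Set.toFinset_card] at hcard
  let e := (Fintype.equivFinOfCardEq hcard).symm
  refine ⟨fun i => e i, fun i => by simpa using hsph (e i).2, ?_⟩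
  have hr : Set.range (fun i => (e i : EuclideanSpace ℝ (Fin d))) =
      (convexHull ℝ (F : Set _)).extremePoints ℝ := by
    change Set.range (Subtype.val ∘ e) = _
    rw [e.surjective.range_comp, Subtype.range_coe]
  rw [hr, hKM]

/-! ### Two orthogonal regular simplices -/

/-- The embedding of `ℝⁿ` onto the first `n` coordinates of `ℝⁿ⁺ⁿ`. -/
def embedFst {n : ℕ} (x : EuclideanSpace ℝ (Fin n)) : EuclideanSpace ℝ (Fin (n + n)) :=
  WithLp.toLp 2 (Fin.append x.ofLp 0)

/-- The embedding of `ℝⁿ` onto the last `n` coordinates of `ℝⁿ⁺ⁿ`. -/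
def embedSnd {n : ℕ} (x : EuclideanSpace ℝ (Fin n)) : EuclideanSpace ℝ (Fin (n + n)) :=
  WithLp.toLp 2 (Fin.append 0 x.ofLp)

theorem inner_embedFst_embedFst {n : ℕ} (x y : EuclideanSpace ℝ (Fin n)) :
    inner ℝ (embedFst x) (embedFst y) = inner ℝ x y := by
  simp [-Fin.natAdd_eq_addNat, embedFst, PiLp.inner_apply, Fin.sum_univ_add]

theorem inner_embedSnd_embedSnd {n : ℕ} (x y : EuclideanSpace ℝ (Fin n)) :
    inner ℝ (embedSnd x) (embedSnd y) = inner ℝ x y := by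
  simp [-Fin.natAdd_eq_addNat, embedSnd, PiLp.inner_apply, Fin.sum_univ_add]

theorem inner_embedFst_embedSnd {n : ℕ} (x y : EuclideanSpace ℝ (Fin n)) :
    inner ℝ (embedFst x) (embedSnd y) = 0 := by
  simp [-Fin.natAdd_eq_addNat, embedFst, embedSnd, PiLp.inner_apply, Fin.sum_univ_add]

theorem embedFst_zero {n : ℕ} : embedFst (0 : EuclideanSpace ℝ (Fin n)) = 0 := by
  ext k
  refine Fin.addCases (fun k => ?_) (fun k => ?_) k <;>
    simp [-Fin.natAdd_eq_addNat, embedFst]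

theorem embedSnd_zero {n : ℕ} : embedSnd (0 : EuclideanSpace ℝ (Fin n)) = 0 := by
  ext k
  refine Fin.addCases (fun k => ?_) (fun k => ?_) k <;>
    simp [-Fin.natAdd_eq_addNat, embedSnd]

theorem sum_embedFst {n : ℕ} {ι : Type*} [Fintype ι] (f : ι → EuclideanSpace ℝ (Fin n)) :
    ∑ i, embedFst (f i) = embedFst (∑ i, f i) := by
  ext k
  refine Fin.addCases (fun k => ?_) (fun k => ?_) k <;>
    simp [-Fin.natAdd_eq_addNat, embedFst]

theorem sum_embedSnd {n : ℕ} {ι : Type*} [Fintype ι] (f : ι → EuclideanSpace ℝ (Fin n)) :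
    ∑ i, embedSnd (f i) = embedSnd (∑ i, f i) := by
  ext k
  refine Fin.addCases (fun k => ?_) (fun k => ?_) k <;>
    simp [-Fin.natAdd_eq_addNat, embedSnd]

theorem assocRealVectors_eq {n : ℕ} {V : Set (EuclideanSpace ℂ (Fin n))}
    (hreal : ∀ w ∈ V, ∀ k, (w k).im = 0) :
    assocRealVectors V = embedFst '' (realPartVec '' V) ∪ embedSnd '' (realPartVec '' V) := by
  rw [assocRealVectors, Set.image_image, Set.image_image]
  congr 1 <;> refine Set.image_congr fun w hw => ?_
  · have : (fun k => (w k).im) = 0 := funext (hreal w hw)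
    simp [assocU, embedFst, realPartVec, this]
  · have : (fun k => -(w k).im) = 0 := funext fun k => by simp [hreal w hw k]
    simp [assocV, embedSnd, realPartVec, this]

theorem norm_realPartVec {n : ℕ} {w : EuclideanSpace ℂ (Fin n)} (hw : ∀ k, (w k).im = 0) :
    ‖realPartVec w‖ = ‖w‖ := by
  rw [EuclideanSpace.norm_eq, EuclideanSpace.norm_eq]
  congr 1
  refine Finset.sum_congr rfl fun k _ => ?_
  have : w k = ((w k).re : ℂ) := Complex.ext rfl (by simpa using hw k)
  rw [this, Complex.norm_real]
  rfl

theorem mainTheorem4 (n : ℕ) (V : Set (EuclideanSpace ℂ (Fin n)))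
    (hunit : ∀ w ∈ V, ‖w‖ = 1) (hV : IsRealRegularSimplexVertexSet V) :
    IsInscribedPolytope (2 * n + 2) (convexHull ℝ (assocRealVectors V)) ∧
      ∀ P : Set (EuclideanSpace ℝ (Fin (n + n))), IsInscribedPolytope (2 * n + 2) P →
        volume P ≤ volume (convexHull ℝ (assocRealVectors V)) := by
  obtain ⟨hreal, s, hs, hsV⟩ := hV
  have h1 : ∀ i, ‖s.points i‖ = 1 := fun i => by
    obtain ⟨w, hw, hwi⟩ : s.points i ∈ realPartVec '' V := hsV ▸ Set.mem_range_self i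
    rw [← hwi, norm_realPartVec (hreal w hw), hunit w hw]
  have hn : n ≠ 0 := by
    rintro rfl
    have := h1 0
    rw [Subsingleton.elim (s.points 0) 0, norm_zero] at this
    exact zero_ne_one this
  obtain ⟨hzero, hinner⟩ := inner_eq_neg_inv_of_equilateral hn s hs h1
  set g : Fin (n + 1) ⊕ Fin (n + 1) → EuclideanSpace ℝ (Fin (n + n)) :=
    Sum.elim (fun i => embedFst (s.points i)) (fun i => embedSnd (s.points i)) with hg
  have hgV : Set.range g = assocRealVectors V := by
    rw [assocRealVectors_eq hreal, ← hsV, ← Set.range_comp, ← Set.range_comp, hg,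
      Set.Sum.elim_range]
    rfl
  have hself : ∀ i, inner ℝ (s.points i) (s.points i) = (1 : ℝ) := fun i => by
    rw [real_inner_self_eq_norm_sq, h1, one_pow]
  have hg1 : ∀ i, ‖g i‖ = 1 := by
    intro i
    rw [← sq_eq_sq₀ (norm_nonneg _) zero_le_one, ← real_inner_self_eq_norm_sq, one_pow]
    rcases i with i | i
    · exact (inner_embedFst_embedFst _ _).trans (hself i)
    · exact (inner_embedSnd_embedSnd _ _).trans (hself i)
  have hgin : ∀ i j, i ≠ j → inner ℝ (g i) (g j) =
      if (i.isLeft ↔ j.isLeft) then -(n : ℝ)⁻¹ else 0 := by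
    rintro (i | i) (j | j) hij
    · simpa [g, inner_embedFst_embedFst] using hinner i j (by rintro rfl; exact hij rfl)
    · simp [g, inner_embedFst_embedSnd]
    · rw [real_inner_comm]
      simp [g, inner_embedFst_embedSnd]
    · simpa [g, inner_embedSnd_embedSnd] using hinner i j (by rintro rfl; exact hij rfl)
  have hnpos : 0 < (n : ℝ)⁻¹ := inv_pos.2 (Nat.cast_pos.2 (Nat.pos_of_ne_zero hn))
  have hginj : Function.Injective g := by
    intro i j hij
    by_contra hne
    have h2 := hgin i j hne
    rw [hij, real_inner_self_eq_norm_sq, hg1, one_pow] at h2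
    split_ifs at h2 <;> linarith
  have hsph : assocRealVectors V ⊆ Metric.sphere 0 1 := by
    rw [← hgV]
    rintro _ ⟨i, rfl⟩
    simpa using hg1 i
  have hm : 2 * n + 2 = n + n + 2 := by ring
  constructor
  · refine ⟨⟨Finset.univ.image g, ?_⟩, ?_, ?_⟩
    · rw [← hgV, Finset.coe_image, Finset.coe_univ, Set.image_univ]
    · rw [extremePoints_convexHull_of_subset_sphere hsph, ← hgV, ← Set.image_univ,
        Set.ncard_image_of_injective _ hginj, Set.ncard_univ, Nat.card_eq_fintype_card,
        Fintype.card_sum, Fintype.card_fin]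
      ring
    · rwa [extremePoints_convexHull_of_subset_sphere hsph]
  · intro P hP
    rw [hm] at hP
    obtain ⟨q, hq, rfl⟩ := hP.exists_eq_convexHull_range
    let e : Fin (n + n + 2) ≃ Fin (n + 1) ⊕ Fin (n + 1) :=
      (finCongr (by ring)).trans finSumFinEquiv.symm
    have hrange : assocRealVectors V = Set.range (g ∘ e) := by
      rw [e.surjective.range_comp, hgV]
    rw [hrange]
    -- both regular simplices are centred at the origin, which gives the affine dependence
    let a : Fin (n + 1) ⊕ Fin (n + 1) → ℝ := Sum.elim (fun _ => 1) (fun _ => -1)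
    have hs2 : √(n : ℝ)⁻¹ ^ 2 = (n : ℝ)⁻¹ := Real.sq_sqrt hnpos.le
    refine volume_convexHull_le_of_inner_eq (s := √(n : ℝ)⁻¹) (Real.sqrt_pos.2 hnpos).ne'
      (g ∘ e) (fun i => hg1 _) (a ∘ e) ?_ ?_ (Finset.univ.filter fun i => (e i).isLeft) ?_ ?_ ?_ q hq
    · exact (e.sum_comp a).trans (by simp [a])
    · refine (e.sum_comp fun i => a i • g i).trans ?_
      simp [a, g, sum_embedFst, sum_embedSnd, hzero, embedFst_zero, embedSnd_zero]
    · intro i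
      rcases h : e i with k | k <;> simp [a, h]
    · exact ⟨e.symm (Sum.inl 0), by simp⟩
    · intro i j hij
      rw [hs2]
      simpa using hgin (e i) (e j) (e.injective.ne hij)
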